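/- Let $0<\mu<1$ and $\lambda_2,\alpha,c>0$. Let $T_1,T_2,\dots,X_1,X_2,\dots$ be jointly independent real random variables on a probability space such that each $T_i$ has the Mittag-Leffler distribution $\mathrm{ML}(\mu,\lambda_2)$, that is, the probability density $f_\mu(t)=\lambda_2 t^{\mu-1}E_{\mu,\mu}(-\lambda_2 t^{\mu})$ for $t>0$ (and $0$ for $t\le 0$), where $E_{a,b}(z)=\sum_{k=0}^{\infty} z^k/\Gamma(ak+b)$, and each $X_i$ is exponentially distributed with rate $\alpha$ (mean $1/\alpha$). For $t>0$ let $N(t)=\#\{n\ge 1: T_1+\dots+T_n\le t\}$, and for $u>0$ let $$R_u(t)=u+ct-\sum_{i=1}^{N(t)}X_i,\qquad \psi_\mu(u)=\mathbb{P}\Big[\inf_{t>0}R_u(t)<0\Big]$$ be the surplus process and the ruin probability of the fractional Poisson risk model with initial capital $u$ and premium rate $c$. Then the equation $$c^\mu x-\alpha c^\mu+\lambda_2x^{1-\mu}=0$$ has exactly one positive solution $x=x_2$, and $$\psi_\mu(u)=\Big(1-\frac{x_2}{\alpha}\Big)e^{-x_2u}\qquad\text{for all } u>0.$$ -/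

import Mathlib

open MeasureTheory ProbabilityTheory

noncomputable section

namespace FractionalRisk

/-- The two-parameter Mittag-Leffler function `E_{a,b}(z) = ∑ z ^ k / Γ(a k + b)`, for real
parameters and real argument. -/
def mittagLeffler (a b z : ℝ) : ℝ :=
  ∑' k : ℕ, z ^ k / Real.Gamma (a * k + b)

/-- The density of the Mittag-Leffler distribution `ML(μ, lam)`:
`lam * x ^ (μ - 1) * E_{μ,μ}(-lam * x ^ μ)` for `x > 0`, and `0` for `x ≤ 0`. -/
def mittagLefflerPDF (μ lam x : ℝ) : ℝ :=
  if 0 < x then lam * x ^ (μ - 1) * mittagLeffler μ μ (-(lam * x ^ μ)) else 0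

/-- The real random variable `Y` is `ML(μ, lam)` distributed under `P`: it has the probability
density `mittagLefflerPDF μ lam`. -/
def HasMittagLefflerLaw {Ω : Type*} [MeasurableSpace Ω] (Y : Ω → ℝ) (μ lam : ℝ)
    (P : Measure Ω) : Prop :=
  AEMeasurable Y P ∧
    Integrable (mittagLefflerPDF μ lam) volume ∧
    ∀ A : Set ℝ, MeasurableSet A → P.real (Y ⁻¹' A) = ∫ x in A, mittagLefflerPDF μ lam x

/-- `N(t)`: the number of claims up to time `t`, that is, the number of `n ≥ 1` such that the
arrival time of the `n`-th claim (the sum of the first `n` inter-arrival times) is at most `t`.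
Inter-arrival times are indexed from `0`, so `T i` is the wait for claim number `i + 1`. -/
def claimCount {Ω : Type*} (T : ℕ → Ω → ℝ) (t : ℝ) (ω : Ω) : ℕ :=
  Set.ncard {n : ℕ | 1 ≤ n ∧ ∑ i ∈ Finset.range n, T i ω ≤ t}

/-- The surplus `R(t) = u + c t - ∑_{i ≤ N(t)} X_i`. -/
def surplus {Ω : Type*} (T X : ℕ → Ω → ℝ) (c u t : ℝ) (ω : Ω) : ℝ :=
  u + c * t - ∑ i ∈ Finset.range (claimCount T t ω), X i ω

/-- The ruin probability `ψ(u) = P(inf_{t > 0} R(t) < 0)` for initial capital `u`. The infimum is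
taken in the extended reals, since paths may be unbounded below. -/
def ruinProbability {Ω : Type*} [MeasurableSpace Ω] (P : Measure Ω) (T X : ℕ → Ω → ℝ)
    (c u : ℝ) : ℝ :=
  P.real {ω | (⨅ t : Set.Ioi (0 : ℝ), (surplus T X c u t ω : EReal)) < 0}

end FractionalRisk

end

/-! Capital rises between claims, so ruin can occur only at a claim, and the question is whether the
walk `u - ∑ (X i - c * T i)` ever becomes negative. Let h be `ruinFormula`: 1 below zero and (1 -
x/α) e^(-xv) for v ≥ 0. Averaging h(v - X) over an exponential claim gives e^(-xv) for v ≥ 0;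
averaging e^(-x(v + cT)) over the waiting time then multiplies by λ/(λ + (cx)^μ), which the root
equation makes equal to 1 - x/α. So h is harmonic for the walk V_n frozen at ruin, and E h(V_n) =
h(u) for every n (`integral_ruinFormula_stoppedSurplus`).

Since 1_{v<0} ≤ h(v) ≤ 1_{v<0} + `killedExp` (x/2) v, P(V_n < 0) differs from h(u) by at most the
mean of the killed exponential. That mean decays geometrically, because the moment generating
function of X - cT is below 1 strictly between 0 and x. Letting n → ∞ gives the formula, without a
law of large numbers. -/

namespace FractionalRisk

/-! ### The characteristic equation and its root -/

section Root

variable {μ lam α c : ℝ}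

lemma strictMonoOn_characteristic (hμ₁ : μ < 1) (hlam : 0 < lam) (hc : 0 < c) :
    StrictMonoOn (fun y : ℝ => c ^ μ * y - α * c ^ μ + lam * y ^ (1 - μ)) (Set.Ici 0) := by
  intro y hy z _ hyz
  have h₁ : y ^ (1 - μ) < z ^ (1 - μ) := Real.rpow_lt_rpow hy hyz (by linarith)
  have h₂ := mul_lt_mul_of_pos_left h₁ hlam
  have h₃ := mul_lt_mul_of_pos_left hyz (Real.rpow_pos_of_pos hc μ)
  simp only
  linarith

/-- The left side is -α c^μ at 0 and λ α^(1-μ) at α. The bound x < α makes 1 - x/α positive and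
keeps exponents up to x within the range where the exponential law has a finite moment generating
function. -/
lemma exists_characteristic_root (hμ₁ : μ < 1) (hlam : 0 < lam) (hα : 0 < α) (hc : 0 < c) :
    ∃ x : ℝ, 0 < x ∧ x < α ∧ c ^ μ * x - α * c ^ μ + lam * x ^ (1 - μ) = 0 := by
  have hcont : ContinuousOn (fun y : ℝ => c ^ μ * y - α * c ^ μ + lam * y ^ (1 - μ))
      (Set.Icc 0 α) := by
    have : Continuous fun y : ℝ => y ^ (1 - μ) := Real.continuous_rpow_const (by linarith)
    fun_prop
  have hcμ := Real.rpow_pos_of_pos hc μ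
  have hαμ := Real.rpow_pos_of_pos hα (1 - μ)
  have h0 : (0 : ℝ) ^ (1 - μ) = 0 := Real.zero_rpow (by linarith)
  obtain ⟨x, hx, hx0⟩ := intermediate_value_Ioo hα.le hcont
    (show (0 : ℝ) ∈ _ by
      simp only [Set.mem_Ioo, h0]
      constructor <;> nlinarith [mul_pos hα hcμ, mul_pos hlam hαμ])
  exact ⟨x, hx.1, hx.2, hx0⟩

/-- Links the sign of the characteristic function at r to whether the moment generating function αλ
/ ((α - r)(λ + (cr)^μ)) of X - cT is above or below 1. -/
lemma sub_mul_add_rpow_eq {r : ℝ} (hr : 0 < r) (hc : 0 < c) :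
    (α - r) * (lam + (c * r) ^ μ) =
      α * lam - r ^ μ * (c ^ μ * r - α * c ^ μ + lam * r ^ (1 - μ)) := by
  have h : r ^ μ * r ^ (1 - μ) = r := by
    rw [← Real.rpow_add hr]; simp
  rw [Real.mul_rpow hc.le hr.le]
  linear_combination lam * h

/-- The moment generating function of `X - c T` at a positive root of the characteristic
equation is `1`. -/
lemma laplace_eq_of_root {x : ℝ} (hx : 0 < x) (hlam : 0 < lam) (hα : 0 < α) (hc : 0 < c)
    (hroot : c ^ μ * x - α * c ^ μ + lam * x ^ (1 - μ) = 0) :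
    lam / (lam + (c * x) ^ μ) = 1 - x / α := by
  have h := sub_mul_add_rpow_eq (μ := μ) (lam := lam) (α := α) hx hc
  have hp := Real.rpow_pos_of_pos (mul_pos hc hx) μ
  rw [hroot] at h
  field_simp
  linarith

/-- Below the positive root of the characteristic equation the moment generating function of
`X - c T` is less than `1`. -/
lemma mgf_lt_one_of_lt_root {x r : ℝ} (hr : 0 < r) (hrx : r < x) (hrα : r < α) (hμ₁ : μ < 1)
    (hlam : 0 < lam) (hc : 0 < c)
    (hroot : c ^ μ * x - α * c ^ μ + lam * x ^ (1 - μ) = 0) :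
    α / (α - r) * (lam / (lam + (c * r) ^ μ)) < 1 := by
  have h := sub_mul_add_rpow_eq (μ := μ) (lam := lam) (α := α) hr hc
  have hp := Real.rpow_pos_of_pos (mul_pos hc hr) μ
  have hneg : c ^ μ * r - α * c ^ μ + lam * r ^ (1 - μ) < 0 :=
    hroot ▸ strictMonoOn_characteristic (α := α) hμ₁ hlam hc hr.le (hr.trans hrx).le hrx
  have := mul_neg_of_pos_of_neg (Real.rpow_pos_of_pos hr μ) hneg
  rw [div_mul_div_comm, div_lt_one (mul_pos (by linarith) (by linarith))]
  linarith

end Root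

/-! ### Laplace transform of the Mittag-Leffler law -/

section Laplace

variable {μ lam : ℝ}

lemma integrableOn_rpow_mul_exp_neg_mul {a s : ℝ} (ha : 0 < a) (hs : 0 < s) :
    IntegrableOn (fun t : ℝ => t ^ (a - 1) * Real.exp (-(s * t))) (Set.Ioi 0) := by
  -- The integral of a non-integrable function is 0 by convention, so a nonzero value proves
  -- integrability.
  refine Integrable.of_integral_ne_zero ?_
  rw [Real.integral_rpow_mul_exp_neg_mul_Ioi ha hs]
  have := Real.Gamma_pos_of_pos ha
  positivity

/-- The Laplace transform of the Mittag-Leffler density where its power series may be integrated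
term by term. -/
lemma integral_exp_mul_mittagLefflerPDF (hμ₀ : 0 < μ) (hlam : 0 < lam) {s : ℝ} (hs : 0 < s)
    (hlams : lam < s ^ μ) :
    ∫ t, Real.exp (-s * t) * mittagLefflerPDF μ lam t = lam / (lam + s ^ μ) := by
  let a : ℕ → ℝ := fun k => μ * k + μ
  have ha : ∀ k, 0 < a k := fun k => by positivity
  have hΓ : ∀ k, 0 < Real.Gamma (a k) := fun k => Real.Gamma_pos_of_pos (ha k)
  have hsμ : 0 < s ^ μ := Real.rpow_pos_of_pos hs μ
  let C : ℕ → ℝ := fun k => lam * (-lam) ^ k / Real.Gamma (a k)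
  let F : ℕ → ℝ → ℝ := fun k t => C k * (t ^ (a k - 1) * Real.exp (-(s * t)))
  have hpow : ∀ k, (1 / s) ^ a k = (s ^ μ)⁻¹ ^ (k + 1) := fun k => by
    rw [one_div, Real.inv_rpow hs.le, inv_pow, ← Real.rpow_mul_natCast hs.le]
    congr 2
    simp only [a]; push_cast; ring
  have hI : ∀ k, ∫ t in Set.Ioi (0 : ℝ), t ^ (a k - 1) * Real.exp (-(s * t)) =
      (s ^ μ)⁻¹ ^ (k + 1) * Real.Gamma (a k) := fun k => by
    rw [Real.integral_rpow_mul_exp_neg_mul_Ioi (ha k) hs, hpow]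
  have hF_int : ∀ k, Integrable (F k) (volume.restrict (Set.Ioi 0)) := fun k =>
    (integrableOn_rpow_mul_exp_neg_mul (ha k) hs).const_mul _
  have hFI : ∀ k, ∫ t in Set.Ioi (0 : ℝ), F k t = lam / s ^ μ * (-(lam / s ^ μ)) ^ k := fun k => by
    simp only [F, integral_const_mul, hI, C]
    have := (hΓ k).ne'
    rw [← neg_div, div_pow, inv_pow]
    field_simp
    ring
  have hFN : ∀ k, ∫ t in Set.Ioi (0 : ℝ), ‖F k t‖ = lam / s ^ μ * (lam / s ^ μ) ^ k := fun k => by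
    have : ∀ t ∈ Set.Ioi (0 : ℝ), ‖F k t‖ = |C k| * (t ^ (a k - 1) * Real.exp (-(s * t))) := by
      intro t ht
      have := Real.rpow_pos_of_pos ht (a k - 1)
      simp only [F, norm_mul, Real.norm_eq_abs, Real.abs_exp, abs_of_pos this]
    rw [setIntegral_congr_fun measurableSet_Ioi this, integral_const_mul, hI]
    simp only [C, abs_div, abs_mul, abs_pow, abs_neg, abs_of_pos hlam, abs_of_pos (hΓ k)]
    have := (hΓ k).ne'
    rw [div_pow, inv_pow]
    field_simp
    ring
  have hq : lam / s ^ μ < 1 := (div_lt_one hsμ).2 hlams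
  have hq0 : 0 < lam / s ^ μ := by positivity
  -- The integrals of the norms form a geometric series of ratio λ / s^μ; its convergence is what
  -- restricts s.
  have hsum := hasSum_integral_of_summable_integral_norm hF_int
    (by simp_rw [hFN]; exact (summable_geometric_of_lt_one hq0.le hq).mul_left _)
  have hgeo : HasSum (fun k => lam / s ^ μ * (-(lam / s ^ μ)) ^ k)
      (lam / s ^ μ * (1 - -(lam / s ^ μ))⁻¹) :=
    (hasSum_geometric_of_abs_lt_one (by rwa [abs_neg, abs_of_pos hq0])).mul_left _
  simp_rw [hFI] at hsum
  have hval : ∫ t in Set.Ioi (0 : ℝ), ∑' k, F k t = lam / (lam + s ^ μ) := by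
    rw [hsum.unique hgeo, sub_neg_eq_add]
    field_simp
    ring
  rw [← hval, ← integral_indicator measurableSet_Ioi]
  refine integral_congr_ae (.of_forall fun t => ?_)
  by_cases ht : 0 < t
  · simp only [mittagLefflerPDF, if_pos ht, Set.indicator_of_mem (Set.mem_Ioi.2 ht),
      mittagLeffler, F, C]
    rw [← tsum_mul_left, ← tsum_mul_left]
    refine tsum_congr fun k => ?_
    have h1 : t ^ (a k - 1) = t ^ (μ - 1) * (t ^ μ) ^ k := by
      rw [← Real.rpow_mul_natCast ht.le, ← Real.rpow_add ht]
      congr 1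
      simp only [a]; ring
    rw [h1, ← neg_mul, mul_pow, neg_mul]
    simp only [a]
    ring
  · simp [mittagLefflerPDF, ht]

end Laplace

section Law

variable {Ω : Type*} [MeasurableSpace Ω] {P : Measure Ω}
  {μ lam : ℝ} {Y : Ω → ℝ}

/-- The alternating series does not show its sign; nonnegativity is read off from the fact that its
set integrals are probabilities. -/
lemma HasMittagLefflerLaw.pdf_nonneg (hY : HasMittagLefflerLaw Y μ lam P) :
    0 ≤ᵐ[volume] mittagLefflerPDF μ lam :=
  ae_nonneg_of_forall_setIntegral_nonneg hY.2.1 fun s hs _ => by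
    rw [← hY.2.2 s hs]; exact measureReal_nonneg

variable [IsProbabilityMeasure P]

lemma HasMittagLefflerLaw.map_eq (hY : HasMittagLefflerLaw Y μ lam P) :
    P.map Y = volume.withDensity fun t => ENNReal.ofReal (mittagLefflerPDF μ lam t) := by
  ext A hA
  rw [Measure.map_apply_of_aemeasurable hY.1 hA, withDensity_apply _ hA,
    ← ofReal_integral_eq_lintegral_ofReal hY.2.1.integrableOn
      (ae_restrict_of_ae hY.pdf_nonneg), ← hY.2.2 A hA, ofReal_measureReal]

lemma HasMittagLefflerLaw.integral_comp (hY : HasMittagLefflerLaw Y μ lam P) {f : ℝ → ℝ}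
    (hf : Measurable f) : ∫ ω, f (Y ω) ∂P = ∫ t, f t * mittagLefflerPDF μ lam t := by
  rw [← integral_map hY.1 hf.aestronglyMeasurable, hY.map_eq,
    integral_withDensity_eq_integral_toReal_smul₀ hY.2.1.1.aemeasurable.ennreal_ofReal
      (.of_forall fun _ => ENNReal.ofReal_lt_top)]
  refine integral_congr_ae ?_
  filter_upwards [hY.pdf_nonneg] with t ht
  rw [ENNReal.toReal_ofReal ht, smul_eq_mul, mul_comm]

lemma HasMittagLefflerLaw.ae_pos (hY : HasMittagLefflerLaw Y μ lam P) : ∀ᵐ ω ∂P, 0 < Y ω := by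
  have h : P.real (Y ⁻¹' Set.Iic 0) = 0 := by
    rw [hY.2.2 _ measurableSet_Iic]
    refine setIntegral_eq_zero_of_forall_eq_zero fun t ht => ?_
    simp [mittagLefflerPDF, not_lt.2 (Set.mem_Iic.1 ht)]
  rw [ae_iff]
  simpa [measureReal_eq_zero_iff, Set.preimage, Set.Iic] using h

lemma HasMittagLefflerLaw.integrable_exp_neg_mul (hY : HasMittagLefflerLaw Y μ lam P) {s : ℝ}
    (hs : 0 ≤ s) : Integrable (fun ω => Real.exp (-s * Y ω)) P := by
  refine Integrable.of_bound (C := 1) (hY.1.const_mul _).exp.aestronglyMeasurable ?_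
  filter_upwards [hY.ae_pos] with ω hω
  rw [Real.norm_eq_abs, Real.abs_exp, Real.exp_le_one_iff]
  nlinarith

/-- The Laplace transform of the Mittag-Leffler distribution, obtained for all `s > 0` by
analytic continuation from large `s`. -/
lemma HasMittagLefflerLaw.mgf_neg (hY : HasMittagLefflerLaw Y μ lam P) (hμ₀ : 0 < μ)
    (hlam : 0 < lam) {s : ℝ} (hs : 0 < s) : mgf Y P (-s) = lam / (lam + s ^ μ) := by
  have hsub : Set.Iio (0 : ℝ) ⊆ interior (integrableExpSet Y P) := by
    refine interior_maximal (fun t ht => ?_) isOpen_Iio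
    have := hY.integrable_exp_neg_mul (s := -t) (by simpa using (Set.mem_Iio.1 ht).le)
    simpa [integrableExpSet] using this
  have h₁ : AnalyticOnNhd ℝ (mgf Y P) (Set.Iio 0) := analyticOnNhd_mgf.mono hsub
  have h₂ : AnalyticOnNhd ℝ (fun t : ℝ => lam / (lam + (-t) ^ μ)) (Set.Iio 0) := by
    intro t ht
    have ht' : 0 < -t := by simpa using ht
    have := Real.rpow_pos_of_pos ht' μ
    refine analyticAt_const.div (analyticAt_const.add ?_) (by positivity)
    have hexp : AnalyticAt ℝ (fun t : ℝ => Real.exp (Real.log (-t) * μ)) t :=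
      ((analyticAt_id.neg.log ht').mul analyticAt_const).rexp
    refine hexp.congr ?_
    filter_upwards [Iio_mem_nhds ht] with y hy
    rw [Real.rpow_def_of_pos (by simpa using hy)]
  have hlim : Filter.Tendsto (fun s : ℝ => s ^ μ) Filter.atTop Filter.atTop :=
    tendsto_rpow_atTop hμ₀
  obtain ⟨M, hM⟩ := Filter.eventually_atTop.1 (hlim.eventually_gt_atTop lam)
  -- Left of `-max M 0` the termwise computation applies, so the two analytic functions agree near
  -- one point of the half-line.
  have hev : mgf Y P =ᶠ[nhds (-(max M 0 + 1))] fun t : ℝ => lam / (lam + (-t) ^ μ) := by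
    have hlt : -(max M 0 + 1) < -max M 0 := by linarith
    filter_upwards [Iio_mem_nhds hlt] with t ht
    have ht' : max M 0 < -t := by linarith [Set.mem_Iio.1 ht]
    have hpos : 0 < -t := (le_max_right _ _).trans_lt ht'
    rw [← integral_exp_mul_mittagLefflerPDF hμ₀ hlam hpos
      (hM _ ((le_max_left _ _).trans ht'.le)), neg_neg]
    exact hY.integral_comp (f := fun y => Real.exp (t * y)) (by fun_prop)
  have := h₁.eqOn_of_preconnected_of_eventuallyEq h₂ isPreconnected_Iio
    (by simp only [Set.mem_Iio]; linarith [le_max_right M 0]) hev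
    (show -s ∈ Set.Iio (0 : ℝ) by simpa using hs)
  simpa using this

end Law

/-! ### Exponential claims and the harmonic function -/

section Exponential

variable {α : ℝ}

lemma integral_expMeasure (hα : 0 < α) (f : ℝ → ℝ) :
    ∫ x, f x ∂expMeasure α = ∫ x in Set.Ioi 0, f x * (α * Real.exp (-(α * x))) := by
  have hm : Measurable (exponentialPDF α) :=
    (measurable_exponentialPDFReal α).ennreal_ofReal
  have : expMeasure α = volume.withDensity (exponentialPDF α) := rfl
  rw [this, integral_withDensity_eq_integral_toReal_smul hm
    (.of_forall fun _ => ENNReal.ofReal_lt_top), ← integral_Ici_eq_integral_Ioi,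
    ← integral_indicator measurableSet_Ici]
  refine integral_congr_ae (.of_forall fun x => ?_)
  by_cases hx : 0 ≤ x
  · have : 0 ≤ α * Real.exp (-(α * x)) := by positivity
    simp [exponentialPDF_of_nonneg hx, hx, ENNReal.toReal_ofReal this, mul_comm]
  · simp [exponentialPDF_of_neg (not_le.1 hx), hx]

lemma integral_exp_mul_expMeasure {r : ℝ} (hα : 0 < α) (hr : r < α) :
    ∫ x, Real.exp (r * x) ∂expMeasure α = α / (α - r) := by
  have h : ∀ x : ℝ, Real.exp (r * x) * (α * Real.exp (-(α * x))) =
      α * Real.exp ((r - α) * x) := fun x => by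
    rw [mul_left_comm, ← Real.exp_add]; ring_nf
  simp_rw [integral_expMeasure hα, h]
  rw [integral_const_mul, integral_exp_mul_Ioi (by linarith)]
  have : α - r ≠ 0 := by linarith
  have : r - α ≠ 0 := by linarith
  rw [mul_zero, Real.exp_zero]
  field_simp
  ring

end Exponential

/-- The ruin probability formula, extended by `1` to negative capital. -/
noncomputable def ruinFormula (α x v : ℝ) : ℝ := if v < 0 then 1 else (1 - x / α) * Real.exp (-x * v)

section RuinFormula

variable {α x : ℝ}

lemma measurable_ruinFormula : Measurable (ruinFormula α x) :=
  Measurable.ite measurableSet_Iio measurable_const (by fun_prop)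

lemma ruinFormula_nonneg (hα : 0 < α) (hxα : x < α) (v : ℝ) : 0 ≤ ruinFormula α x v := by
  have : x / α < 1 := (div_lt_one hα).2 hxα
  unfold ruinFormula
  split_ifs
  · exact zero_le_one
  · exact mul_nonneg (by linarith) (Real.exp_nonneg _)

lemma ruinFormula_le_one (hα : 0 < α) (hx : 0 < x) (hxα : x < α) (v : ℝ) :
    ruinFormula α x v ≤ 1 := by
  have : x / α < 1 := (div_lt_one hα).2 hxα
  have : 0 < x / α := div_pos hx hα
  unfold ruinFormula
  split_ifs with hv
  · exact le_rfl
  · refine mul_le_one₀ (by linarith) (Real.exp_nonneg _) (Real.exp_le_one_iff.2 ?_)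
    nlinarith

/-- Claims y ≤ v contribute e^(-xv) - e^(-αv), and ruinous claims y > v contribute e^(-αv). The
prefactor 1 - x/α is exactly what makes these cancel. -/
lemma integral_ruinFormula_sub (hα : 0 < α) (hx : 0 < x) (hxα : x < α) {v : ℝ} (hv : 0 ≤ v) :
    ∫ y, ruinFormula α x (v - y) ∂expMeasure α = Real.exp (-x * v) := by
  have hd : α - x ≠ 0 := by linarith
  have hd' : x - α ≠ 0 := by linarith
  have h₁ : Set.EqOn (fun y => ruinFormula α x (v - y) * (α * Real.exp (-(α * y))))
      (fun y => (α - x) * Real.exp (-x * v) * Real.exp ((x - α) * y)) (Set.Ioc 0 v) := by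
    intro y hy
    simp only [ruinFormula, if_neg (not_lt.2 (sub_nonneg.2 hy.2))]
    have : Real.exp (-x * (v - y)) * Real.exp (-(α * y)) =
        Real.exp (-x * v) * Real.exp ((x - α) * y) := by
      rw [← Real.exp_add, ← Real.exp_add]; ring_nf
    have hα' : (1 - x / α) * α = α - x := by field_simp
    linear_combination (1 - x / α) * α * this +
      Real.exp (-x * v) * Real.exp ((x - α) * y) * hα'
  have h₂ : Set.EqOn (fun y => ruinFormula α x (v - y) * (α * Real.exp (-(α * y))))
      (fun y => α * Real.exp (-α * y)) (Set.Ioi v) := by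
    intro y hy
    simp only [ruinFormula, if_pos (sub_neg.2 (Set.mem_Ioi.1 hy)), one_mul, neg_mul]
  have i₁ : IntegrableOn (fun y => (α - x) * Real.exp (-x * v) * Real.exp ((x - α) * y))
      (Set.Ioc 0 v) :=
    (Continuous.integrableOn_Icc (by fun_prop)).mono_set Set.Ioc_subset_Icc_self
  have i₂ : IntegrableOn (fun y => α * Real.exp (-α * y)) (Set.Ioi v) :=
    (integrableOn_exp_mul_Ioi (by linarith) v).const_mul α
  rw [integral_expMeasure hα, ← Set.Ioc_union_Ioi_eq_Ioi hv,
    setIntegral_union Set.Ioc_disjoint_Ioi_same measurableSet_Ioi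
      (i₁.congr_fun h₁.symm measurableSet_Ioc) (i₂.congr_fun h₂.symm measurableSet_Ioi),
    setIntegral_congr_fun measurableSet_Ioc h₁, setIntegral_congr_fun measurableSet_Ioi h₂,
    integral_const_mul, integral_const_mul, integral_exp_mul_Ioi (by linarith),
    ← intervalIntegral.integral_of_le hv,
    intervalIntegral.integral_comp_mul_left (fun y => Real.exp y) hd', integral_exp]
  have : Real.exp ((x - α) * v) * Real.exp (-x * v) = Real.exp (-α * v) := by
    rw [← Real.exp_add]; ring_nf
  rw [mul_zero, Real.exp_zero, smul_eq_mul, ← this]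
  field_simp
  ring

end RuinFormula

/-! ### The walk frozen at ruin -/

/-- The path `v, v - y 0, v - y 0 - y 1, …`, frozen as soon as it is negative. -/
noncomputable def stoppedWalk (v : ℝ) (y : ℕ → ℝ) : ℕ → ℝ
  | 0 => v
  | n + 1 => if stoppedWalk v y n < 0 then stoppedWalk v y n else stoppedWalk v y n - y n

section StoppedWalk

variable {v : ℝ} {y z : ℕ → ℝ}

lemma stoppedWalk_congr {n : ℕ} (h : ∀ i < n, y i = z i) :
    stoppedWalk v y n = stoppedWalk v z n := by
  induction n with
  | zero => rfl
  | succ n ih =>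
    simp only [stoppedWalk, ih fun i hi => h i (hi.trans n.lt_succ_self), h n n.lt_succ_self]

lemma stoppedWalk_eq_of_nonneg {n : ℕ} (h : 0 ≤ stoppedWalk v y n) :
    stoppedWalk v y n = v - ∑ i ∈ Finset.range n, y i := by
  induction n with
  | zero => simp [stoppedWalk]
  | succ n ih =>
    simp only [stoppedWalk] at h ⊢
    split_ifs at h ⊢ with hn
    · exact absurd h (not_le.2 hn)
    · rw [ih (not_lt.1 hn), Finset.sum_range_succ]; ring

/-- Up to and including the first negative index, the frozen and free walks coincide. -/
lemma exists_stoppedWalk_neg_iff :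
    (∃ n, stoppedWalk v y n < 0) ↔ ∃ n, v - ∑ i ∈ Finset.range n, y i < 0 := by
  constructor
  · intro h
    classical
    refine ⟨Nat.find h, ?_⟩
    have hneg := Nat.find_spec h
    have hmin : ∀ m < Nat.find h, 0 ≤ stoppedWalk v y m := fun m hm =>
      not_lt.1 (Nat.find_min h hm)
    rcases hn : Nat.find h with _ | n
    · simpa [hn, stoppedWalk] using hneg
    · rw [hn] at hneg hmin
      have h0 := hmin n n.lt_succ_self
      rw [stoppedWalk, if_neg (not_lt.2 h0), stoppedWalk_eq_of_nonneg h0] at hneg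
      rw [Finset.sum_range_succ]
      linarith
  · rintro ⟨n, hn⟩
    by_contra! h
    rw [← stoppedWalk_eq_of_nonneg (h n)] at hn
    exact absurd hn (not_lt.2 (h n))

lemma monotone_stoppedWalk_neg : Monotone fun n => stoppedWalk v y n < 0 :=
  monotone_nat_of_le_succ fun n h => by
    rw [stoppedWalk, if_pos h]; exact h

end StoppedWalk

lemma measurable_stoppedWalk {β : Type*} [MeasurableSpace β] {v : ℝ} {y : β → ℕ → ℝ}
    (hy : ∀ i, Measurable fun b => y b i) (n : ℕ) :
    Measurable fun b => stoppedWalk v (y b) n := by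
  induction n with
  | zero => exact measurable_const
  | succ n ih => exact Measurable.ite (measurableSet_lt ih measurable_const) ih (ih.sub (hy n))

lemma aemeasurable_stoppedWalk {β : Type*} [MeasurableSpace β] {ν : Measure β} {v : ℝ}
    {y : β → ℕ → ℝ} (hy : ∀ i, AEMeasurable (fun b => y b i) ν) (n : ℕ) :
    AEMeasurable (fun b => stoppedWalk v (y b) n) ν := by
  refine ⟨fun b => stoppedWalk v (fun i => (hy i).mk _ b) n,
    measurable_stoppedWalk (fun i => (hy i).measurable_mk) n, ?_⟩
  filter_upwards [ae_all_iff.2 fun i => (hy i).ae_eq_mk] with b hb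
  exact stoppedWalk_congr fun i _ => hb i

/-! ### Independence and the one-step Markov property -/

/-- The capital just after the `n`-th claim, frozen at ruin. -/
noncomputable def stoppedSurplus {Ω : Type*} (T X : ℕ → Ω → ℝ) (c u : ℝ) (n : ℕ) (ω : Ω) : ℝ :=
  stoppedWalk u (fun i => X i ω - c * T i ω) n

section Step

variable {Ω : Type*} [MeasurableSpace Ω] {P : Measure Ω}
  {T X : ℕ → Ω → ℝ} {c u : ℝ}

lemma aemeasurable_stoppedSurplus (hT : ∀ i, AEMeasurable (T i) P)
    (hX : ∀ i, AEMeasurable (X i) P) (n : ℕ) : AEMeasurable (stoppedSurplus T X c u n) P :=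
  aemeasurable_stoppedWalk (fun i => (hX i).sub ((hT i).const_mul c)) n

/-- The frozen walk at step n is a measurable function of the `T i`, `X i` with i < n only. -/
lemma indepFun_stoppedSurplus (hT : ∀ i, AEMeasurable (T i) P)
    (hX : ∀ i, AEMeasurable (X i) P) (hindep : iIndepFun (Sum.elim T X) P) (n : ℕ) :
    IndepFun (stoppedSurplus T X c u n) (fun ω => (T n ω, X n ω)) P := by
  classical
  let S : Finset (ℕ ⊕ ℕ) := (Finset.range n).disjSum (Finset.range n)
  let S' : Finset (ℕ ⊕ ℕ) := {Sum.inl n, Sum.inr n}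
  have hdisj : Disjoint S S' := by
    rw [Finset.disjoint_right]
    intro a ha
    simp only [S', Finset.mem_insert, Finset.mem_singleton] at ha
    rcases ha with rfl | rfl <;> simp [S]
  have hmeas : ∀ i, AEMeasurable (Sum.elim T X i) P := by
    rintro (i | i)
    exacts [hT i, hX i]
  -- `stoppedWalk` expects an infinite sequence; the padding value 0 is never read in the first n
  -- steps.
  let ext (i : ℕ ⊕ ℕ) (z : S → ℝ) : ℝ := if h : i ∈ S then z ⟨i, h⟩ else 0
  have hext : ∀ i, Measurable (ext i) := fun i => by
    by_cases h : i ∈ S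
    · simpa only [ext, h, dif_pos] using measurable_pi_apply _
    · simpa only [ext, h, dif_neg, not_false_eq_true] using measurable_const
  let φ : (S → ℝ) → ℝ := fun z =>
    stoppedWalk u (fun i => ext (Sum.inr i) z - c * ext (Sum.inl i) z) n
  have hφ : Measurable φ :=
    measurable_stoppedWalk (fun i => (hext _).sub ((hext _).const_mul c)) n
  let ψ : (S' → ℝ) → ℝ × ℝ := fun z =>
    (z ⟨Sum.inl n, by simp [S']⟩, z ⟨Sum.inr n, by simp [S']⟩)
  have hψ : Measurable ψ := by fun_prop
  have h := (hindep.indepFun_finset₀ S S' hdisj hmeas).comp hφ hψ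
  have hVφ : stoppedSurplus T X c u n = φ ∘ fun ω (i : S) => Sum.elim T X i ω := by
    funext ω
    refine stoppedWalk_congr fun i hi => ?_
    simp [ext, S, hi]
  rw [hVφ]
  exact h

variable [IsProbabilityMeasure P]

lemma integral_comp_stoppedSurplus (hT : ∀ i, AEMeasurable (T i) P)
    (hX : ∀ i, AEMeasurable (X i) P) (hindep : iIndepFun (Sum.elim T X) P) (n : ℕ)
    {G : ℝ × ℝ × ℝ → ℝ} (hG : Measurable G) (hG1 : ∀ p, ‖G p‖ ≤ 1) :
    ∫ ω, G (stoppedSurplus T X c u n ω, T n ω, X n ω) ∂P =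
      ∫ ω, (∫ t, ∫ x, G (stoppedSurplus T X c u n ω, t, x) ∂P.map (X n) ∂P.map (T n)) ∂P := by
  have hV := aemeasurable_stoppedSurplus (c := c) (u := u) hT hX n
  have hTX : IndepFun (T n) (X n) P := hindep.indepFun (i := Sum.inl n) (j := Sum.inr n) (by simp)
  have := Measure.isProbabilityMeasure_map hV
  have := Measure.isProbabilityMeasure_map (hT n)
  have := Measure.isProbabilityMeasure_map (hX n)
  have hmap : P.map (fun ω => (stoppedSurplus T X c u n ω, T n ω, X n ω)) =
      (P.map (stoppedSurplus T X c u n)).prod ((P.map (T n)).prod (P.map (X n))) := by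
    rw [← hTX.map_prod_eq_prod_map_map (hT n) (hX n)]
    exact (indepFun_stoppedSurplus hT hX hindep n).map_prod_eq_prod_map_map hV
      ((hT n).prodMk (hX n))
  rw [← integral_map (φ := fun ω => (stoppedSurplus T X c u n ω, T n ω, X n ω))
    (hV.prodMk ((hT n).prodMk (hX n))) hG.aestronglyMeasurable, hmap,
    integral_prod _ (Integrable.of_bound hG.aestronglyMeasurable 1 (.of_forall hG1))]
  have hinner : ∀ v, ∫ p, G (v, p) ∂(P.map (T n)).prod (P.map (X n)) =
      ∫ t, ∫ x, G (v, t, x) ∂P.map (X n) ∂P.map (T n) := fun v =>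
    integral_prod _ (Integrable.of_bound
      (hG.comp measurable_prodMk_left).aestronglyMeasurable 1 (.of_forall fun p => hG1 _))
  rw [integral_map hV]
  · simp_rw [hinner]
  · exact hG.stronglyMeasurable.integral_prod_right'.aestronglyMeasurable

lemma integral_comp_stoppedSurplus_succ (hT : ∀ i, AEMeasurable (T i) P)
    (hX : ∀ i, AEMeasurable (X i) P) (hindep : iIndepFun (Sum.elim T X) P) (n : ℕ)
    {F : ℝ → ℝ} (hF : Measurable F) (hF1 : ∀ v, ‖F v‖ ≤ 1) :
    ∫ ω, F (stoppedSurplus T X c u (n + 1) ω) ∂P =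
      ∫ ω, (if stoppedSurplus T X c u n ω < 0 then F (stoppedSurplus T X c u n ω) else
        ∫ t, ∫ x, F (stoppedSurplus T X c u n ω + c * t - x) ∂P.map (X n) ∂P.map (T n)) ∂P := by
  have := Measure.isProbabilityMeasure_map (hT n)
  have := Measure.isProbabilityMeasure_map (hX n)
  let G : ℝ × ℝ × ℝ → ℝ := fun p => if p.1 < 0 then F p.1 else F (p.1 + c * p.2.1 - p.2.2)
  have hG : Measurable G :=
    Measurable.ite (measurableSet_lt measurable_fst measurable_const) (by fun_prop) (by fun_prop)
  have hG1 : ∀ p, ‖G p‖ ≤ 1 := fun p => by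
    simp only [G]; split_ifs <;> exact hF1 _
  have h := integral_comp_stoppedSurplus (c := c) (u := u) hT hX hindep n hG hG1
  convert h using 3 with ω ω
  · simp only [G, stoppedSurplus, stoppedWalk]
    split_ifs
    · rfl
    · congr 1; ring
  · simp only [G]
    split_ifs <;> simp

end Step

/-! ### Harmonicity, geometric decay and the ruin probability of the walk -/

section Ruin

variable {Ω : Type*} [MeasurableSpace Ω] {P : Measure Ω} [IsProbabilityMeasure P]
  {T X : ℕ → Ω → ℝ} {μ lam α c u x : ℝ}

lemma integral_ruinFormula_stoppedSurplus_succ (hμ₀ : 0 < μ) (hlam : 0 < lam)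
    (hα : 0 < α) (hc : 0 < c) (hx : 0 < x) (hxα : x < α)
    (hroot : c ^ μ * x - α * c ^ μ + lam * x ^ (1 - μ) = 0)
    (hT : ∀ i, HasMittagLefflerLaw (T i) μ lam P) (hX : ∀ i, HasLaw (X i) (expMeasure α) P)
    (hindep : iIndepFun (Sum.elim T X) P) (n : ℕ) :
    ∫ ω, ruinFormula α x (stoppedSurplus T X c u (n + 1) ω) ∂P =
      ∫ ω, ruinFormula α x (stoppedSurplus T X c u n ω) ∂P := by
  rw [integral_comp_stoppedSurplus_succ (fun i => (hT i).1) (fun i => (hX i).aemeasurable)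
    hindep n measurable_ruinFormula fun v => by
      rw [Real.norm_of_nonneg (ruinFormula_nonneg hα hxα v)]
      exact ruinFormula_le_one hα hx hxα v]
  congr 1 with ω
  set v := stoppedSurplus T X c u n ω
  split_ifs with hv
  · rfl
  have hv' := not_lt.1 hv
  have hpos : ∀ᵐ t ∂P.map (T n), 0 < t :=
    (ae_map_iff (hT n).1 measurableSet_Ioi).2 (hT n).ae_pos
  -- Positivity of t keeps `v + c * t` nonnegative, where the exponential average is known.
  have hin : ∀ᵐ t ∂P.map (T n), ∫ y, ruinFormula α x (v + c * t - y) ∂P.map (X n) =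
      Real.exp (-x * v) * Real.exp (-(c * x) * t) := by
    filter_upwards [hpos] with t ht
    rw [(hX n).map_eq, integral_ruinFormula_sub hα hx hxα (by positivity), ← Real.exp_add]
    ring_nf
  have hmgf := (hT n).mgf_neg hμ₀ hlam (mul_pos hc hx)
  rw [mgf, ← integral_map (f := fun t => Real.exp (-(c * x) * t)) (hT n).1
    (by fun_prop)] at hmgf
  rw [integral_congr_ae hin, integral_const_mul, hmgf, laplace_eq_of_root hx hlam hα hc hroot,
    ruinFormula, if_neg hv, mul_comm]

lemma integral_ruinFormula_stoppedSurplus (hμ₀ : 0 < μ) (hlam : 0 < lam)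
    (hα : 0 < α) (hc : 0 < c) (hx : 0 < x) (hxα : x < α)
    (hroot : c ^ μ * x - α * c ^ μ + lam * x ^ (1 - μ) = 0)
    (hT : ∀ i, HasMittagLefflerLaw (T i) μ lam P) (hX : ∀ i, HasLaw (X i) (expMeasure α) P)
    (hindep : iIndepFun (Sum.elim T X) P) (n : ℕ) :
    ∫ ω, ruinFormula α x (stoppedSurplus T X c u n ω) ∂P = ruinFormula α x u := by
  induction n with
  | zero => simp [stoppedSurplus, stoppedWalk]
  | succ n ih =>
    rw [integral_ruinFormula_stoppedSurplus_succ hμ₀ hlam hα hc hx hxα hroot hT hX hindep, ih]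

/-- The function `e ^ (-r v)`, killed at negative arguments. -/
noncomputable def killedExp (r v : ℝ) : ℝ := if v < 0 then 0 else Real.exp (-r * v)

lemma measurable_killedExp {r : ℝ} : Measurable (killedExp r) :=
  Measurable.ite measurableSet_Iio measurable_const (by fun_prop)

lemma killedExp_nonneg (r v : ℝ) : 0 ≤ killedExp r v := by
  unfold killedExp; split_ifs
  exacts [le_rfl, Real.exp_nonneg _]

lemma killedExp_le_one {r : ℝ} (hr : 0 ≤ r) (v : ℝ) : killedExp r v ≤ 1 := by
  unfold killedExp; split_ifs with hv
  · exact zero_le_one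
  · rw [Real.exp_le_one_iff]; nlinarith

lemma killedExp_le_exp (r v : ℝ) : killedExp r v ≤ Real.exp (-r * v) := by
  unfold killedExp; split_ifs
  exacts [Real.exp_nonneg _, le_rfl]

lemma integrable_killedExp_comp {Y : Ω → ℝ} (hY : AEMeasurable Y P) {r : ℝ} (hr : 0 ≤ r) :
    Integrable (fun ω => killedExp r (Y ω)) P :=
  Integrable.of_bound (measurable_killedExp.comp_aemeasurable hY).aestronglyMeasurable 1
    (.of_forall fun ω => by
      rw [Real.norm_of_nonneg (killedExp_nonneg r _)]; exact killedExp_le_one hr _)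

/-- From v ≥ 0, dropping the killing after the step only increases the mean, which then factors as
e^(-rv) times the moment generating function of X - cT at r. From v < 0 both sides vanish. -/
lemma integral_killedExp_stoppedSurplus_succ_le {r : ℝ} (hμ₀ : 0 < μ) (hlam : 0 < lam)
    (hα : 0 < α) (hc : 0 < c) (hr : 0 < r) (hrα : r < α)
    (hT : ∀ i, HasMittagLefflerLaw (T i) μ lam P) (hX : ∀ i, HasLaw (X i) (expMeasure α) P)
    (hindep : iIndepFun (Sum.elim T X) P) (n : ℕ) :
    ∫ ω, killedExp r (stoppedSurplus T X c u (n + 1) ω) ∂P ≤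
      α / (α - r) * (lam / (lam + (c * r) ^ μ)) *
        ∫ ω, killedExp r (stoppedSurplus T X c u n ω) ∂P := by
  have hTm := fun i => (hT i).1
  have hXm := fun i => (hX i).aemeasurable
  rw [integral_comp_stoppedSurplus_succ hTm hXm hindep n measurable_killedExp fun v => by
      rw [Real.norm_of_nonneg (killedExp_nonneg r v)]
      exact killedExp_le_one hr.le v, ← integral_const_mul]
  have hmgf := (hT n).mgf_neg hμ₀ hlam (mul_pos hc hr)
  have hTint := (integrable_map_measure (f := T n) (g := fun t => Real.exp (-(c * r) * t))
    (μ := P) (by fun_prop) (hT n).1).2 ((hT n).integrable_exp_neg_mul (by positivity))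
  rw [mgf, ← integral_map (f := fun t => Real.exp (-(c * r) * t)) (hT n).1
    (by fun_prop)] at hmgf
  have hexp := integral_exp_mul_expMeasure hα hrα
  have hpos : 0 < α / (α - r) := div_pos hα (by linarith)
  have hXint : Integrable (fun y => Real.exp (r * y)) (expMeasure α) :=
    Integrable.of_integral_ne_zero (by rw [hexp]; exact hpos.ne')
  refine integral_mono_of_nonneg (.of_forall fun ω => ?_)
    ((integrable_killedExp_comp (aemeasurable_stoppedSurplus hTm hXm n) hr.le).const_mul _)
    (.of_forall fun ω => ?_)
  · simp only [Pi.zero_apply]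
    split_ifs
    · exact killedExp_nonneg _ _
    · exact integral_nonneg fun t => integral_nonneg fun y => killedExp_nonneg _ _
  · simp only
    set v := stoppedSurplus T X c u n ω
    split_ifs with hv
    · simp [killedExp, hv]
    · have hin : ∀ t, ∫ y, killedExp r (v + c * t - y) ∂P.map (X n) ≤
          α / (α - r) * Real.exp (-r * v) * Real.exp (-(c * r) * t) := fun t => by
        have hrhs : α / (α - r) * Real.exp (-r * v) * Real.exp (-(c * r) * t) =
            ∫ y, Real.exp (-r * v) * Real.exp (-(c * r) * t) * Real.exp (r * y) ∂expMeasure α := by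
          rw [integral_const_mul, hexp]; ring
        rw [(hX n).map_eq, hrhs]
        refine integral_mono_of_nonneg (.of_forall fun y => killedExp_nonneg _ _)
          (hXint.const_mul _) (.of_forall fun y => (killedExp_le_exp _ _).trans_eq ?_)
        simp only
        rw [← Real.exp_add, ← Real.exp_add]
        ring_nf
      calc _ ≤ ∫ t, α / (α - r) * Real.exp (-r * v) * Real.exp (-(c * r) * t) ∂P.map (T n) :=
            integral_mono_of_nonneg
              (.of_forall fun t => integral_nonneg fun y => killedExp_nonneg _ _)
              (hTint.const_mul _) (.of_forall hin)
        _ = _ := by rw [integral_const_mul, hmgf, killedExp, if_neg hv]; ring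

lemma tendsto_integral_killedExp_stoppedSurplus {r : ℝ} (hμ₀ : 0 < μ) (hμ₁ : μ < 1)
    (hlam : 0 < lam) (hα : 0 < α) (hc : 0 < c) (hr : 0 < r) (hrx : r < x) (hxα : x < α)
    (hroot : c ^ μ * x - α * c ^ μ + lam * x ^ (1 - μ) = 0)
    (hT : ∀ i, HasMittagLefflerLaw (T i) μ lam P) (hX : ∀ i, HasLaw (X i) (expMeasure α) P)
    (hindep : iIndepFun (Sum.elim T X) P) :
    Filter.Tendsto (fun n => ∫ ω, killedExp r (stoppedSurplus T X c u n ω) ∂P)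
      Filter.atTop (nhds 0) := by
  have hrα := hrx.trans hxα
  have hlt := mgf_lt_one_of_lt_root hr hrx hrα hμ₁ hlam hc hroot
  set q := α / (α - r) * (lam / (lam + (c * r) ^ μ))
  have hq : 0 ≤ q := by
    have : 0 < α - r := by linarith
    positivity
  have hle : ∀ n, ∫ ω, killedExp r (stoppedSurplus T X c u n ω) ∂P ≤ q ^ n := by
    intro n
    induction n with
    | zero => simpa [stoppedSurplus, stoppedWalk] using killedExp_le_one hr.le u
    | succ n ih =>
      refine (integral_killedExp_stoppedSurplus_succ_le hμ₀ hlam hα hc hr hrα hT hX hindep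
        n).trans ?_
      rw [pow_succ']
      exact mul_le_mul_of_nonneg_left ih hq
  exact squeeze_zero (fun n => integral_nonneg fun ω => killedExp_nonneg _ _) hle
    (tendsto_pow_atTop_nhds_zero_of_lt_one hq hlt)

/-- The probability that the frozen random walk ever becomes negative. -/
lemma measureReal_exists_stoppedSurplus_neg (hμ₀ : 0 < μ) (hμ₁ : μ < 1)
    (hlam : 0 < lam) (hα : 0 < α) (hc : 0 < c) (hx : 0 < x) (hxα : x < α)
    (hroot : c ^ μ * x - α * c ^ μ + lam * x ^ (1 - μ) = 0)
    (hT : ∀ i, HasMittagLefflerLaw (T i) μ lam P) (hX : ∀ i, HasLaw (X i) (expMeasure α) P)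
    (hindep : iIndepFun (Sum.elim T X) P) :
    P.real {ω | ∃ n, stoppedSurplus T X c u n ω < 0} = ruinFormula α x u := by
  have hVm : ∀ n, AEMeasurable (stoppedSurplus T X c u n) P :=
    aemeasurable_stoppedSurplus (fun i => (hT i).1) (fun i => (hX i).aemeasurable)
  have hnull : ∀ n, NullMeasurableSet {ω | stoppedSurplus T X c u n ω < 0} P := fun n =>
    nullMeasurableSet_lt (hVm n) aemeasurable_const
  have hmono : Monotone fun n => {ω | stoppedSurplus T X c u n ω < 0} :=
    fun m n hmn ω h => monotone_stoppedWalk_neg hmn h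
  have hlim : Filter.Tendsto (fun n => P.real {ω | stoppedSurplus T X c u n ω < 0}) Filter.atTop
      (nhds (P.real {ω | ∃ n, stoppedSurplus T X c u n ω < 0})) := by
    rw [Set.ofPred_exists]
    exact (ENNReal.tendsto_toReal (measure_ne_top _ _)).comp (tendsto_measure_iUnion_atTop hmono)
  -- Any exponent strictly between 0 and x would serve.
  have hr : 0 < x / 2 := by positivity
  have hkill := tendsto_integral_killedExp_stoppedSurplus (u := u) hμ₀ hμ₁ hlam hα hc hr
    (half_lt_self hx) hxα hroot hT hX hindep
  have hint : ∀ n, Integrable (fun ω => ruinFormula α x (stoppedSurplus T X c u n ω)) P := fun n =>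
    Integrable.of_bound (measurable_ruinFormula.comp_aemeasurable (hVm n)).aestronglyMeasurable 1
      (.of_forall fun ω => by
        rw [Real.norm_of_nonneg (ruinFormula_nonneg hα hxα _)]
        exact ruinFormula_le_one hα hx hxα _)
  have hind : ∀ n, P.real {ω | stoppedSurplus T X c u n ω < 0} =
      ∫ ω, {ω | stoppedSurplus T X c u n ω < 0}.indicator 1 ω ∂P := fun n => by
    rw [integral_indicator₀ (hnull n)]; simp
  have hindint : ∀ n, Integrable ({ω | stoppedSurplus T X c u n ω < 0}.indicator
      (1 : Ω → ℝ)) P := fun n => (integrable_const (1 : ℝ)).indicator₀ (hnull n)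
  have hval := fun n => integral_ruinFormula_stoppedSurplus (u := u) hμ₀ hlam hα hc hx hxα hroot
    hT hX hindep n
  have hα1 : x / α < 1 := (div_lt_one hα).2 hxα
  have hupper : ∀ n, P.real {ω | stoppedSurplus T X c u n ω < 0} ≤ ruinFormula α x u := fun n => by
    rw [← hval n, hind n]
    refine integral_mono (hindint n) (hint n) fun ω => ?_
    by_cases h : stoppedSurplus T X c u n ω < 0
    · simp [Set.indicator, ruinFormula, h]
    · simpa [Set.indicator, h] using ruinFormula_nonneg hα hxα _
  have hlower : ∀ n, ruinFormula α x u - ∫ ω, killedExp (x / 2) (stoppedSurplus T X c u n ω) ∂P ≤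
      P.real {ω | stoppedSurplus T X c u n ω < 0} := fun n => by
    rw [sub_le_iff_le_add, ← hval n, hind n,
      ← integral_add (hindint n) (integrable_killedExp_comp (hVm n) hr.le)]
    refine integral_mono (hint n)
      ((hindint n).add (integrable_killedExp_comp (hVm n) hr.le)) fun ω => ?_
    by_cases h : stoppedSurplus T X c u n ω < 0
    · simp [Set.indicator, ruinFormula, killedExp, h]
    · simp only [Set.indicator, ruinFormula, killedExp, h, Set.mem_ofPred_eq, if_false, zero_add]
      have h' := not_lt.1 h
      calc _ ≤ 1 * Real.exp (-x * stoppedSurplus T X c u n ω) := by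
            gcongr; linarith [div_pos hx hα]
        _ ≤ _ := by rw [one_mul, Real.exp_le_exp]; nlinarith
  refine tendsto_nhds_unique hlim (tendsto_of_tendsto_of_tendsto_of_le_of_le ?_
    tendsto_const_nhds hlower hupper)
  simpa using hkill.const_sub (ruinFormula α x u)

end Ruin

/-! ### From continuous time to claim epochs -/

section Path

variable {Ω : Type*} {T X : ℕ → Ω → ℝ} {c u : ℝ} {ω : Ω}

lemma claimCount_eq {t : ℝ} {m : ℕ}
    (hS : StrictMono fun n => ∑ i ∈ Finset.range n, T i ω)
    (hm : ∑ i ∈ Finset.range m, T i ω ≤ t) (hm' : t < ∑ i ∈ Finset.range (m + 1), T i ω) :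
    claimCount T t ω = m := by
  have : {n : ℕ | 1 ≤ n ∧ ∑ i ∈ Finset.range n, T i ω ≤ t} = Finset.Icc 1 m := by
    ext n
    simp only [Set.mem_ofPred_eq, Finset.coe_Icc, Set.mem_Icc, and_congr_right_iff]
    refine fun _ => ⟨fun h => ?_, fun h => (hS.monotone h).trans hm⟩
    exact Nat.lt_succ_iff.1 (hS.lt_iff_lt.1 (h.trans_lt hm'))
  rw [claimCount, this, Set.ncard_coe_finset, Nat.card_Icc, Nat.add_sub_cancel]

lemma exists_sum_le_lt {t : ℝ} (ht : 0 ≤ t)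
    (hS : ∃ n, t < ∑ i ∈ Finset.range n, T i ω) :
    ∃ m, ∑ i ∈ Finset.range m, T i ω ≤ t ∧ t < ∑ i ∈ Finset.range (m + 1), T i ω := by
  classical
  have hspec := Nat.find_spec hS
  rcases hn : Nat.find hS with _ | m
  · rw [hn] at hspec
    simp only [Finset.range_zero, Finset.sum_empty] at hspec
    exact absurd hspec (not_lt.2 ht)
  · rw [hn] at hspec
    exact ⟨m, not_lt.1 (Nat.find_min hS (by omega)), hspec⟩

/-- Ruin can only happen at a claim arrival. -/
lemma iInf_surplus_neg_iff (hc : 0 < c) (hu : 0 < u) (hpos : ∀ i, 0 < T i ω)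
    (hS : ∀ t : ℝ, ∃ n, t < ∑ i ∈ Finset.range n, T i ω) :
    (⨅ t : Set.Ioi (0 : ℝ), (surplus T X c u t ω : EReal)) < 0 ↔
      ∃ n, stoppedSurplus T X c u n ω < 0 := by
  have hmono : StrictMono fun n => ∑ i ∈ Finset.range n, T i ω :=
    strictMono_nat_of_lt_succ fun n => by
      rw [Finset.sum_range_succ]; linarith [hpos n]
  have hsum : ∀ n, u - ∑ i ∈ Finset.range n, (X i ω - c * T i ω) =
      u + c * ∑ i ∈ Finset.range n, T i ω - ∑ i ∈ Finset.range n, X i ω := fun n => by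
    rw [Finset.sum_sub_distrib, Finset.mul_sum]; ring
  simp only [stoppedSurplus, exists_stoppedWalk_neg_iff, iInf_lt_iff, hsum]
  constructor
  · rintro ⟨⟨t, ht⟩, hneg⟩
    -- Unbounded arrival times make the claim count at t genuinely finite; an infinite set would
    -- have `ncard` 0. Capital just after claim m (the initial capital if m = 0) is at most that at
    -- t.
    obtain ⟨m, hm, hm'⟩ := exists_sum_le_lt (le_of_lt ht) (hS t)
    refine ⟨m, ?_⟩
    have hneg : surplus T X c u t ω < 0 := by exact_mod_cast hneg
    rw [surplus, claimCount_eq hmono hm hm'] at hneg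
    have := mul_le_mul_of_nonneg_left hm hc.le
    linarith
  · rintro ⟨n, hn⟩
    -- Positive initial capital excludes n = 0, so the ruin time is positive, as the infimum over t
    -- > 0 requires.
    have hn0 : n ≠ 0 := by
      rintro rfl
      simp only [Finset.range_zero, Finset.sum_empty] at hn
      linarith
    have ht : 0 < ∑ i ∈ Finset.range n, T i ω := by
      simpa using hmono (Nat.pos_of_ne_zero hn0)
    refine ⟨⟨_, ht⟩, ?_⟩
    have : surplus T X c u (∑ i ∈ Finset.range n, T i ω) ω < 0 := by
      rwa [surplus, claimCount_eq hmono le_rfl (hmono n.lt_succ_self)]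
    exact_mod_cast this

end Path

/-! ### Almost sure properties of the arrivals and conclusion -/

section Ruin

variable {Ω : Type*} [MeasurableSpace Ω] {P : Measure Ω} [IsProbabilityMeasure P]
  {T X : ℕ → Ω → ℝ} {μ lam α c u x : ℝ}

/-- Almost surely the arrival times are unbounded. -/
lemma ae_exists_lt_sum (hμ₀ : 0 < μ) (hlam : 0 < lam)
    (hT : ∀ i, HasMittagLefflerLaw (T i) μ lam P) (hindep : iIndepFun T P) :
    ∀ᵐ ω ∂P, ∀ t : ℝ, ∃ n, t < ∑ i ∈ Finset.range n, T i ω := by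
  have hTm := fun i => (hT i).1
  -- Chernoff's bound at exponent -1 will give P(S_n ≤ K) ≤ e^K (λ/(λ+1))^n, which tends to 0 for
  -- each K.
  have hmgf : ∀ n, mgf (∑ i ∈ Finset.range n, T i) P (-1) = (lam / (lam + 1)) ^ n := fun n => by
    rw [hindep.mgf_sum₀ hTm, Finset.prod_congr rfl fun i _ => (hT i).mgf_neg hμ₀ hlam one_pos]
    simp [div_pow]
  have hint : ∀ n, Integrable (fun ω => Real.exp (-1 * (∑ i ∈ Finset.range n, T i) ω)) P :=
    fun n => Integrable.of_integral_ne_zero (by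
      have : 0 < (lam / (lam + 1)) ^ n := by positivity
      exact ((hmgf n).trans_ne this.ne'))
  have hK : ∀ K : ℕ, ∀ᵐ ω ∂P, ∃ n, (K : ℝ) < ∑ i ∈ Finset.range n, T i ω := fun K => by
    rw [ae_iff, ← measureReal_eq_zero_iff]
    refine le_antisymm ?_ measureReal_nonneg
    have hlim : Filter.Tendsto (fun n : ℕ => Real.exp K * (lam / (lam + 1)) ^ n) Filter.atTop
        (nhds 0) := by
      simpa using (tendsto_pow_atTop_nhds_zero_of_lt_one (by positivity)
        ((div_lt_one (by positivity)).2 (lt_add_one lam))).const_mul (Real.exp K)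
    refine ge_of_tendsto' hlim fun n => ?_
    have h := measure_le_le_exp_mul_mgf (K : ℝ) (by norm_num : (-1 : ℝ) ≤ 0) (hint n)
    rw [hmgf, neg_neg, one_mul] at h
    refine (measureReal_mono fun ω hω => ?_).trans h
    simp only [Set.mem_ofPred_eq, not_exists, not_lt, Finset.sum_apply] at hω ⊢
    exact hω n
  filter_upwards [ae_all_iff.2 hK] with ω hω t
  obtain ⟨K, hK⟩ := exists_nat_gt t
  obtain ⟨n, hn⟩ := hω K
  exact ⟨n, hK.trans hn⟩

lemma ruinProbability_eq (hμ₀ : 0 < μ) (hμ₁ : μ < 1)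
    (hlam : 0 < lam) (hα : 0 < α) (hc : 0 < c) (hx : 0 < x) (hxα : x < α) (hu : 0 < u)
    (hroot : c ^ μ * x - α * c ^ μ + lam * x ^ (1 - μ) = 0)
    (hT : ∀ i, HasMittagLefflerLaw (T i) μ lam P) (hX : ∀ i, HasLaw (X i) (expMeasure α) P)
    (hindep : iIndepFun (Sum.elim T X) P) :
    ruinProbability P T X c u = (1 - x / α) * Real.exp (-x * u) := by
  have hruin := measureReal_exists_stoppedSurplus_neg (u := u) hμ₀ hμ₁ hlam hα hc hx hxα hroot
    hT hX hindep
  rw [ruinFormula, if_neg (not_lt.2 hu.le)] at hruin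
  have hTindep : iIndepFun T P := hindep.precomp (g := Sum.inl) Sum.inl_injective
  rw [← hruin, ruinProbability]
  refine measureReal_congr ?_
  filter_upwards [ae_all_iff.2 fun i => (hT i).ae_pos,
    ae_exists_lt_sum hμ₀ hlam hT hTindep] with ω hpos hS
  exact propext (iInf_surplus_neg_iff hc hu hpos hS)

end Ruin

end FractionalRisk

theorem mainTheorem8 {Ω : Type*} [MeasurableSpace Ω] (P : Measure Ω) [IsProbabilityMeasure P]
    (μ lam₂ α c : ℝ) (hμ₀ : 0 < μ) (hμ₁ : μ < 1) (hlam : 0 < lam₂) (hα : 0 < α) (hc : 0 < c)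
    (T X : ℕ → Ω → ℝ)
    (hT : ∀ i, FractionalRisk.HasMittagLefflerLaw (T i) μ lam₂ P)
    (hX : ∀ i, HasLaw (X i) (expMeasure α) P)
    (hindep : iIndepFun (Sum.elim T X) P) :
    ∃ x₂ : ℝ,
      (0 < x₂ ∧ c ^ μ * x₂ - α * c ^ μ + lam₂ * x₂ ^ (1 - μ) = 0) ∧
      (∀ y : ℝ, 0 < y → c ^ μ * y - α * c ^ μ + lam₂ * y ^ (1 - μ) = 0 → y = x₂) ∧
      ∀ u : ℝ, 0 < u →
        FractionalRisk.ruinProbability P T X c u = (1 - x₂ / α) * Real.exp (-x₂ * u) := by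
  obtain ⟨x, hx, hxα, hroot⟩ := FractionalRisk.exists_characteristic_root hμ₁ hlam hα hc
  refine ⟨x, ⟨hx, hroot⟩, fun y hy hyroot => ?_, fun u hu => ?_⟩
  · exact (FractionalRisk.strictMonoOn_characteristic (α := α) hμ₁ hlam hc).injOn hy.le hx.le
      (hyroot.trans hroot.symm)
  · exact FractionalRisk.ruinProbability_eq hμ₀ hμ₁ hlam hα hc hx hxα hu hroot hT hX hindep
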